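/- Conventions. $C^*$-algebras are complex and need not be unital; $M(\mathcal B)\supseteq\mathcal B$ is the multiplier algebra of $\mathcal B$. A morphism $\varphi:\mathcal A\to M(\mathcal B)$ of $C^*$-algebras is non-degenerate if $\operatorname{span}(\varphi(\mathcal A)\mathcal B)$ is dense in $\mathcal B$, and a representation $\pi:\mathcal A\to B(\mathcal H)$ is non-degenerate if $\operatorname{span}(\pi(\mathcal A)\mathcal H)$ is dense in $\mathcal H$; $\tilde\varphi:M(\mathcal A)\to M(\mathcal B)$ and $\tilde\pi:M(\mathcal A)\to B(\mathcal H)$ denote the unique extensions to $M(\mathcal A)$. $\mathrm{Rep}(\mathcal A,\mathcal H)$ is the set of non-degenerate representations of $\mathcal A$ on the complex Hilbert space $\mathcal H$. Let $G$ be a topological group. A host algebra for $G$ is a pair $(\mathcal L,\eta)$ of a $C^*$-algebra $\mathcal L$ and a group homomorphism $\eta:G\to U(M(\mathcal L))$ such that for every complex Hilbert space $\mathcal H$ the unitary representation $\tilde\pi\circ\eta$ of $G$ is strongly continuous for each $\pi\in\mathrm{Rep}(\mathcal L,\mathcal H)$, and $\pi\mapsto\tilde\pi\circ\eta$ is injective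 on $\mathrm{Rep}(\mathcal L,\mathcal H)$. The representations $U=\tilde\pi\circ\eta$ are called $\mathcal L$-representations of $G$, and then $U_{\mathcal L}:=\pi$. Let $\mathcal A$ be a $C^*$-algebra and $\alpha:G\to\mathrm{Aut}(\mathcal A)$ a group homomorphism (no continuity assumed). A covariant representation of $(\mathcal A,G,\alpha)$ on $\mathcal H$ is a pair $(\pi,U)$ of a non-degenerate representation $\pi$ of $\mathcal A$ and a strongly continuous unitary representation $U$ of $G$ on $\mathcal H$ with $U(g)\pi(A)U(g)^*=\pi(\alpha_g(A))$ for all $g\in G$, $A\in\mathcal A$. A crossed product host for $(\alpha,\mathcal L)$ is a triple $(\mathcal C,\eta_{\mathcal A},\eta_{\mathcal L})$ of a $C^*$-algebra $\mathcal C$ and morphisms $\eta_{\mathcal A}:\mathcal A\to M(\mathcal C)$, $\eta_{\mathcal L}:\mathcal L\to M(\mathcal C)$ of $C^*$-algebras such that $\eta_{\mathcal L}$ is non-degenerate; with $\eta_G:=\tilde\eta_{\mathcal L}\circ\eta$ one has $\eta_G(g)\eta_{\mathcal A}(A)\eta_G(g)^*=\eta_{\mathcal A}(\alpha_g(A))$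 for all $g\in G$, $A\in\mathcal A$; and $\eta_{\mathcal A}(\mathcal A)\eta_{\mathcal L}(\mathcal L)\subseteq\mathcal C$, where this set generates $\mathcal C$ as a $C^*$-algebra. It is full if, in addition, for every covariant representation $(\pi,U)$ of $(\mathcal A,G,\alpha)$ on a Hilbert space $\mathcal H$ for which $U$ is an $\mathcal L$-representation there is a unique representation $\rho:\mathcal C\to B(\mathcal H)$ with $\rho(\eta_{\mathcal A}(A)\eta_{\mathcal L}(L))=\pi(A)U_{\mathcal L}(L)$ for all $A\in\mathcal A$, $L\in\mathcal L$. For a crossed product host put $$\mathrm{Rep}(\alpha,\mathcal H)_{\eta_\times}:=\{(\tilde\rho\circ\eta_{\mathcal A},\ \tilde\rho\circ\eta_G) : \rho\in\mathrm{Rep}(\mathcal C,\mathcal H)\}.$$ Theorem (Uniqueness Theorem). Let $(\mathcal L,\eta)$ be a host algebra for the topological group $G$, let $\mathcal A$ be a $C^*$-algebra and $\alpha:G\to\mathrm{Aut}(\mathcal A)$ a group homomorphism. Let $(\mathcal C,\eta_{\mathcal A},\eta_{\mathcal L})$ and $(\mathcal C^\sharp,\eta_{\mathcal A}^\sharp,\eta_{\mathcal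 L}^\sharp)$ be crossed product hosts for $(\alpha,\mathcal L)$ such that $\mathrm{Rep}(\alpha,\mathcal H)_{\eta_\times}=\mathrm{Rep}(\alpha,\mathcal H)_{\eta^\sharp_\times}$ for every complex Hilbert space $\mathcal H$. Then there exists a unique isomorphism of $C^*$-algebras $\phi:\mathcal C\to\mathcal C^\sharp$ with $\tilde\phi\circ\eta_{\mathcal A}=\eta_{\mathcal A}^\sharp$ and $\tilde\phi\circ\eta_{\mathcal L}=\eta_{\mathcal L}^\sharp$. In particular, any two full crossed product hosts for $(\alpha,\mathcal L)$ are isomorphic, i.e. there is an isomorphism $\Phi$ of their $C^*$-algebras with $\tilde\Phi\circ\eta_{\mathcal A}=\eta_{\mathcal A}^\sharp$ and $\tilde\Phi\circ\eta_{\mathcal L}=\eta_{\mathcal L}^\sharp$. -/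

import Mathlib

open scoped MultiplierAlgebra InnerProductSpace Topology
open Filter

universe u v w

namespace CPHost

/-! ### Multiplier algebras and multiplier extensions

`𝓜(ℂ, A)` is Mathlib's multiplier algebra (double centralizers) `M(A)` of a C⋆-algebra `A`, and
`DoubleCentralizer.coeHom : A →⋆ₙₐ[ℂ] 𝓜(ℂ, A)` is the canonical embedding `ι_A`.  In this part
the extension of non-degenerate morphisms to multiplier algebras is constructed. -/

section Action

variable {X : Type*} [NormedAddCommGroup X] [NormedSpace ℂ X]

/-- `span (φ(A) X)` is dense in `X`. -/
def NondegAction {A : Type*} (φ : A → X → X) : Prop :=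
  Dense (Submodule.span ℂ {y : X | ∃ a x, φ a x = y} : Set X)

lemma NondegAction.ext {A : Type*} {φ : A → X → X} (h : NondegAction φ) {S T : X →L[ℂ] X}
    (hST : ∀ a x, S (φ a x) = T (φ a x)) : S = T := by
  refine ContinuousLinearMap.ext_on h ?_
  rintro _ ⟨a, x, rfl⟩
  exact hST a x

variable {A : Type*} [NonUnitalCStarAlgebra A]

lemma eq_of_forall_mul_left {a b : A} (h : ∀ z : A, z * a = z * b) : a = b := by
  have h1 : star (a - b) * (a - b) = 0 := by rw [mul_sub, h, sub_self]
  exact sub_eq_zero.mp ((CStarRing.star_mul_self_eq_zero_iff _).mp h1)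

lemma fst_mul (m : 𝓜(ℂ, A)) (a b : A) : m.fst (a * b) = m.fst a * b := by
  apply eq_of_forall_mul_left
  intro z
  rw [← m.central, ← mul_assoc, m.central, mul_assoc]

lemma star_fst_star_mul (m : 𝓜(ℂ, A)) (a b : A) :
    star ((star m).fst a) * b = star a * m.fst b := by
  rw [DoubleCentralizer.star_fst, star_star, m.central]

/-- The linear map `ℂ[A × X] → X`, `(a, x) ↦ φ(f(a)) x`. -/
noncomputable def actLin (φ : A →ₗ[ℂ] (X →L[ℂ] X)) (f : A →ₗ[ℂ] A) : (A × X →₀ ℂ) →ₗ[ℂ] X :=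
  Finsupp.linearCombination ℂ fun p : A × X => φ (f p.1) p.2

/-- For an action `φ` of `A` on `X` (by contractions, with `span φ(A)X` dense), the bounded operator
on `X` by which the multiplier `m` acts: `φ(a) x ↦ φ(m a) x`. -/
noncomputable def actExt [CompleteSpace X] (φ : A →ₗ[ℂ] (X →L[ℂ] X)) (m : 𝓜(ℂ, A)) : X →L[ℂ] X :=
  (actLin φ (m.fst : A →ₗ[ℂ] A)).extendOfNorm (actLin φ LinearMap.id)

lemma actLin_mul_left (φ : A →ₗ[ℂ] (X →L[ℂ] X)) (hmul : ∀ a b x, φ (a * b) x = φ a (φ b x))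
    (m : 𝓜(ℂ, A)) (e : A) (t : A × X →₀ ℂ) :
    actLin φ ((m.fst : A →ₗ[ℂ] A) ∘ₗ LinearMap.mulLeft ℂ e) t
      = φ (m.fst e) (actLin φ LinearMap.id t) := by
  simp only [actLin, Finsupp.linearCombination_apply, Finsupp.sum, map_sum, map_smul]
  refine Finset.sum_congr rfl fun p _ => ?_
  simp [fst_mul, hmul]

lemma norm_actLin_le (φ : A →ₗ[ℂ] (X →L[ℂ] X)) (hmul : ∀ a b x, φ (a * b) x = φ a (φ b x))
    (hnorm : ∀ a, ‖φ a‖ ≤ ‖a‖) (m : 𝓜(ℂ, A)) (t : A × X →₀ ℂ) :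
    ‖actLin φ (m.fst : A →ₗ[ℂ] A) t‖ ≤ ‖m‖ * ‖actLin φ LinearMap.id t‖ := by
  let _ := CStarAlgebra.spectralOrder A
  let _ := CStarAlgebra.spectralOrderedRing A
  have hl := CStarAlgebra.increasingApproximateUnit A
  have hφ : Continuous φ := by
    refine AddMonoidHomClass.continuous_of_bound φ 1 fun a => ?_
    simpa using hnorm a
  have hlim : Tendsto (fun e : A => actLin φ ((m.fst : A →ₗ[ℂ] A) ∘ₗ LinearMap.mulLeft ℂ e) t)
      (CStarAlgebra.approximateUnit A) (𝓝 (actLin φ (m.fst : A →ₗ[ℂ] A) t)) := by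
    simp only [actLin, Finsupp.linearCombination_apply, Finsupp.sum]
    refine tendsto_finsetSum _ fun p _ => Tendsto.const_smul ?_ _
    have h1 : Tendsto (fun e : A => e * p.1) (CStarAlgebra.approximateUnit A) (𝓝 p.1) :=
      hl.tendsto_mul_right p.1
    have h2 : Continuous fun a : A => φ (m.fst a) p.2 := by
      have : Continuous fun a : A => φ (m.fst a) := hφ.comp m.fst.continuous
      exact this.clm_apply continuous_const
    exact (h2.tendsto p.1).comp h1
  refine le_of_tendsto hlim.norm ?_
  filter_upwards [hl.eventually_norm] with e he
  rw [actLin_mul_left φ hmul]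
  refine (ContinuousLinearMap.le_opNorm _ _).trans ?_
  gcongr
  refine (hnorm _).trans ((m.fst.le_opNorm e).trans ?_)
  rw [DoubleCentralizer.norm_fst]
  exact mul_le_of_le_one_right (norm_nonneg _) he

lemma denseRange_actLin {φ : A →ₗ[ℂ] (X →L[ℂ] X)} (h : NondegAction fun a x => φ a x) :
    DenseRange (actLin φ LinearMap.id) := by
  have : Set.range (actLin φ LinearMap.id)
      = (Submodule.span ℂ {y : X | ∃ a x, φ a x = y} : Set X) := by
    rw [← LinearMap.coe_range, actLin, Finsupp.range_linearCombination]
    congr 2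
    ext y
    simp
  rw [DenseRange, this]
  exact h

lemma actExt_apply [CompleteSpace X] {φ : A →ₗ[ℂ] (X →L[ℂ] X)}
    (hmul : ∀ a b x, φ (a * b) x = φ a (φ b x)) (hnorm : ∀ a, ‖φ a‖ ≤ ‖a‖)
    (h : NondegAction fun a x => φ a x) (m : 𝓜(ℂ, A)) (a : A) (x : X) :
    actExt φ m (φ a x) = φ (m.fst a) x := by
  have := LinearMap.extendOfNorm_eq (denseRange_actLin h)
    ⟨‖m‖, norm_actLin_le φ hmul hnorm m⟩ (Finsupp.single (a, x) 1)
  simpa [actLin, actExt] using this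

end Action

section Hom

variable {A : Type*} [NonUnitalCStarAlgebra A] {B : Type*} [NonUnitalCStarAlgebra B]
variable {H : Type*} [NormedAddCommGroup H] [InnerProductSpace ℂ H] [CompleteSpace H]

/-- A representation of `A` on the Hilbert space `H` is non-degenerate if `span (π(A) H)` is
dense in `H`. -/
def NondegRep (π : A →⋆ₙₐ[ℂ] (H →L[ℂ] H)) : Prop :=
  NondegAction fun (a : A) (x : H) => π a x

/-- A morphism `φ : A → M(B)` is non-degenerate if `span (φ(A) B)` is dense in `B`. -/
def NondegHom (φ : A →⋆ₙₐ[ℂ] 𝓜(ℂ, B)) : Prop :=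
  NondegAction fun (a : A) (b : B) => (φ a).fst b

/-- The action of `A` on `H` given by a representation. -/
noncomputable def repAct (π : A →⋆ₙₐ[ℂ] (H →L[ℂ] H)) : A →ₗ[ℂ] (H →L[ℂ] H) where
  toFun a := π a
  map_add' := map_add π
  map_smul' := map_smul π

/-- The action of `A` on `B` by left multiplication given by a morphism `A → M(B)`. -/
noncomputable def homAct (φ : A →⋆ₙₐ[ℂ] 𝓜(ℂ, B)) : A →ₗ[ℂ] (B →L[ℂ] B) where
  toFun a := (φ a).fst
  map_add' a b := by rw [map_add]; rfl
  map_smul' c a := by rw [map_smul]; rfl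

lemma actExt_repAct {π : A →⋆ₙₐ[ℂ] (H →L[ℂ] H)} (hπ : NondegRep π) (m : 𝓜(ℂ, A)) (a : A) (x : H) :
    actExt (repAct π) m (π a x) = π (m.fst a) x :=
  actExt_apply (φ := repAct π) (fun a b x => by simp [repAct])
    (fun a => NonUnitalStarAlgHom.norm_apply_le π a) hπ m a x

lemma actExt_homAct {φ : A →⋆ₙₐ[ℂ] 𝓜(ℂ, B)} (hφ : NondegHom φ) (m : 𝓜(ℂ, A)) (a : A) (b : B) :
    actExt (homAct φ) m ((φ a).fst b) = (φ (m.fst a)).fst b :=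
  actExt_apply (φ := homAct φ) (fun a b x => by simp [homAct])
    (fun a => by
      change ‖(φ a).fst‖ ≤ ‖a‖
      rw [DoubleCentralizer.norm_fst]
      exact NonUnitalStarAlgHom.norm_apply_le φ a) hφ m a b

lemma NondegRep.adjoint_actExt {π : A →⋆ₙₐ[ℂ] (H →L[ℂ] H)} (hπ : NondegRep π) (m : 𝓜(ℂ, A)) :
    actExt (repAct π) (star m) = star (actExt (repAct π) m) := by
  refine NondegAction.ext hπ fun a x => ?_
  refine ext_inner_right ℂ fun z => ?_
  rw [ContinuousLinearMap.star_eq_adjoint, ContinuousLinearMap.adjoint_inner_left,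
    actExt_repAct hπ]
  have key : ((innerSL ℂ (π ((star m).fst a) x)) : H →L[ℂ] ℂ)
      = (innerSL ℂ (π a x)) ∘L (actExt (repAct π) m) := by
    refine ContinuousLinearMap.ext_on hπ ?_
    rintro _ ⟨b, y, rfl⟩
    simp only [innerSL_apply_apply, ContinuousLinearMap.comp_apply]
    rw [actExt_repAct hπ, ← ContinuousLinearMap.adjoint_inner_right,
      ← ContinuousLinearMap.adjoint_inner_right, ← ContinuousLinearMap.star_eq_adjoint,
      ← ContinuousLinearMap.star_eq_adjoint, ← map_star π, ← map_star π,
      ← mul_apply_eq_comp, ← mul_apply_eq_comp, ← map_mul, ← map_mul, star_fst_star_mul]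
  simpa using congrArg (fun f => f z) key

/-- The multiplier extension `π̃ : M(A) → B(H)` of a non-degenerate representation `π` of `A`:
the representation with `π̃(m) π(a) x = π(m a) x`. -/
noncomputable def repExt (π : A →⋆ₙₐ[ℂ] (H →L[ℂ] H)) (hπ : NondegRep π) :
    𝓜(ℂ, A) →⋆ₐ[ℂ] (H →L[ℂ] H) where
  toFun m := actExt (repAct π) m
  map_one' := NondegAction.ext hπ fun a x => by rw [actExt_repAct hπ]; simp
  map_mul' m n := NondegAction.ext hπ fun a x => by
    rw [mul_apply_eq_comp, actExt_repAct hπ, actExt_repAct hπ, actExt_repAct hπ]; simp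
  map_zero' := NondegAction.ext hπ fun a x => by rw [actExt_repAct hπ]; simp
  map_add' m n := NondegAction.ext hπ fun a x => by
    rw [add_apply, actExt_repAct hπ, actExt_repAct hπ, actExt_repAct hπ]; simp
  commutes' c := NondegAction.ext hπ fun a x => by
    rw [actExt_repAct hπ]; simp [Algebra.algebraMap_eq_smul_one]
  map_star' m := hπ.adjoint_actExt m

lemma homAct_central {φ : A →⋆ₙₐ[ℂ] 𝓜(ℂ, B)} (hφ : NondegHom φ) (m : 𝓜(ℂ, A)) (x y : B) :
    star (actExt (homAct φ) (star m) (star x)) * y = x * actExt (homAct φ) m y := by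
  have hst (a c : A) (b d : B) :
      star ((φ a).fst b) * (φ c).fst d = star b * (φ (star a * c)).fst d := by
    have h := star_fst_star_mul (star (φ a)) b ((φ c).fst d)
    rw [star_star] at h
    rw [h, map_mul, map_star, DoubleCentralizer.mul_fst, mul_apply_eq_comp]
  -- first for `x = (φ(a) b)*` and `y = φ(c) d`, then by density in `y` and in `x`
  have h1 (a : A) (b : B) : (ContinuousLinearMap.mul ℂ B (star ((φ ((star m).fst a)).fst b)))
      = (ContinuousLinearMap.mul ℂ B (star ((φ a).fst b))) ∘L (actExt (homAct φ) m) := by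
    refine NondegAction.ext hφ fun c d => ?_
    simp only [ContinuousLinearMap.comp_apply, ContinuousLinearMap.mul_apply']
    rw [actExt_homAct hφ, hst, hst, star_fst_star_mul]
  have h2 : (ContinuousLinearMap.mul ℂ B (star y)) ∘L (actExt (homAct φ) (star m))
      = ContinuousLinearMap.mul ℂ B (star (actExt (homAct φ) m y)) := by
    refine NondegAction.ext hφ fun a b => ?_
    simp only [ContinuousLinearMap.comp_apply, ContinuousLinearMap.mul_apply']
    rw [actExt_homAct hφ]
    have := congrArg (fun f => star (f y)) (h1 a b)
    simpa using this
  have := congrArg (fun f => star (f (star x))) h2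
  simpa using this

/-- The multiplier `φ̃(m)` of `B`, with left action `φ(a) b ↦ φ(m a) b`. -/
noncomputable def homExtFun (φ : A →⋆ₙₐ[ℂ] 𝓜(ℂ, B)) (hφ : NondegHom φ) (m : 𝓜(ℂ, A)) :
    𝓜(ℂ, B) where
  fst := actExt (homAct φ) m
  snd := (((starₗᵢ ℂ : B ≃ₗᵢ⋆[ℂ] B) : B →L⋆[ℂ] B).comp (actExt (homAct φ) (star m))).comp
          ((starₗᵢ ℂ : B ≃ₗᵢ⋆[ℂ] B) : B →L⋆[ℂ] B)
  central := homAct_central hφ m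

/-- A multiplier is determined by its left action. -/
lemma ext_fst {m n : 𝓜(ℂ, B)} (h : m.fst = n.fst) : m = n := by
  refine DoubleCentralizer.ext _ _ _ _ (Prod.ext h ?_)
  ext x
  have hz (z : B) : m.snd x * z = n.snd x * z := by
    rw [m.central, n.central, h]
  refine star_injective (eq_of_forall_mul_left fun z => ?_)
  simpa using congrArg star (hz (star z))

/-- The multiplier extension `φ̃ : M(A) → M(B)` of a non-degenerate morphism `φ : A → M(B)`:
the unital morphism with `φ̃(m) φ(a) b = φ(m a) b`. -/
noncomputable def homExt (φ : A →⋆ₙₐ[ℂ] 𝓜(ℂ, B)) (hφ : NondegHom φ) :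
    𝓜(ℂ, A) →⋆ₐ[ℂ] 𝓜(ℂ, B) where
  toFun m := homExtFun φ hφ m
  map_one' := ext_fst <| NondegAction.ext hφ fun a x => by
    simp [homExtFun, actExt_homAct hφ]
  map_mul' m n := ext_fst <| NondegAction.ext hφ fun a x => by
    simp [homExtFun, actExt_homAct hφ]
  map_zero' := ext_fst <| NondegAction.ext hφ fun a x => by
    simp [homExtFun, actExt_homAct hφ]
  map_add' m n := ext_fst <| NondegAction.ext hφ fun a x => by
    simp [homExtFun, actExt_homAct hφ]
  commutes' c := ext_fst <| NondegAction.ext hφ fun a x => by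
    simp [homExtFun, actExt_homAct hφ, Algebra.algebraMap_eq_smul_one]
  map_star' m := ext_fst <| by
    ext x
    simp [homExtFun]

/-- `π̃ ∘ ι_A = π`. -/
lemma repExt_coe (π : A →⋆ₙₐ[ℂ] (H →L[ℂ] H)) (hπ : NondegRep π) (a : A) :
    repExt π hπ (DoubleCentralizer.coeHom (𝕜 := ℂ) a) = π a :=
  NondegAction.ext hπ fun b x => (actExt_repAct hπ _ b x).trans (by simp)

/-- `φ̃ ∘ ι_A = φ`. -/
lemma homExt_coe (φ : A →⋆ₙₐ[ℂ] 𝓜(ℂ, B)) (hφ : NondegHom φ) (a : A) :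
    homExt φ hφ (DoubleCentralizer.coeHom (𝕜 := ℂ) a) = φ a :=
  ext_fst <| NondegAction.ext hφ fun b x => (actExt_homAct hφ _ b x).trans (by simp)

/-- An isomorphism `Φ : A ≅ B`, regarded as a morphism `A → M(B)`. -/
noncomputable def isoHom (Φ : A ≃⋆ₐ[ℂ] B) : A →⋆ₙₐ[ℂ] 𝓜(ℂ, B) :=
  (DoubleCentralizer.coeHom (𝕜 := ℂ)).comp (Φ : A →⋆ₙₐ[ℂ] B)

lemma isoHom_nondeg (Φ : A ≃⋆ₐ[ℂ] B) : NondegHom (isoHom Φ) := by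
  let _ := CStarAlgebra.spectralOrder B
  let _ := CStarAlgebra.spectralOrderedRing B
  intro b
  have hl := CStarAlgebra.increasingApproximateUnit B
  refine mem_closure_of_tendsto (hl.tendsto_mul_right b) (Eventually.of_forall fun e => ?_)
  exact Submodule.subset_span ⟨Φ.symm e, b, by simp [isoHom]⟩

/-- The multiplier extension `Φ̃ : M(A) → M(B)` of an isomorphism `Φ : A ≅ B`. -/
noncomputable def isoExt (Φ : A ≃⋆ₐ[ℂ] B) : 𝓜(ℂ, A) →⋆ₐ[ℂ] 𝓜(ℂ, B) :=
  homExt (isoHom Φ) (isoHom_nondeg Φ)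

end Hom

/-! ### Representations, host algebras, covariant representations -/

/-- `Rep(A, H)`: the non-degenerate representations of the C⋆-algebra `A` on `H`. -/
abbrev Rep (A : Type*) [NonUnitalCStarAlgebra A]
    (H : Type*) [NormedAddCommGroup H] [InnerProductSpace ℂ H] [CompleteSpace H] :=
  {π : A →⋆ₙₐ[ℂ] (H →L[ℂ] H) // NondegRep π}

/-- `U : G → U(H)` is a (strong operator) continuous unitary representation. -/
def IsStronglyContinuous {G : Type*} [Group G] [TopologicalSpace G]
    {H : Type*} [NormedAddCommGroup H] [InnerProductSpace ℂ H] [CompleteSpace H]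
    (U : G →* unitary (H →L[ℂ] H)) : Prop :=
  ∀ x : H, Continuous fun g : G => (U g : H →L[ℂ] H) x

/-- The map `η^* : π ↦ π̃ ∘ η`, for a homomorphism `η : G → U(M(L))`. -/
noncomputable def etaStar {G : Type*} [Group G] {L : Type*} [NonUnitalCStarAlgebra L]
    (η : G →* unitary 𝓜(ℂ, L))
    {H : Type*} [NormedAddCommGroup H] [InnerProductSpace ℂ H] [CompleteSpace H]
    (π : Rep L H) : G →* unitary (H →L[ℂ] H) :=
  (Unitary.map (StarMonoidHom.ofClass (repExt π.1 π.2))).toMonoidHom.comp η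

/-- A host algebra structure on the C⋆-algebra `L` for the topological group `G`. -/
structure HostAlgebra (G : Type v) [Group G] [TopologicalSpace G] (L : Type u)
    [NonUnitalCStarAlgebra L] where
  /-- The homomorphism `G → U(M(L))`. -/
  η : G →* unitary 𝓜(ℂ, L)
  /-- `π̃ ∘ η` is continuous for every non-degenerate representation `π` of `L`. -/
  continuous : ∀ (H : Type u) [NormedAddCommGroup H] [InnerProductSpace ℂ H] [CompleteSpace H]
    (π : Rep L H), IsStronglyContinuous (etaStar η π)
  /-- `η^*` is injective on `Rep(L, H)` for every Hilbert space `H`. -/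
  injective : ∀ (H : Type u) [NormedAddCommGroup H] [InnerProductSpace ℂ H] [CompleteSpace H],
    Function.Injective (etaStar η : Rep L H → (G →* unitary (H →L[ℂ] H)))

section Covariant

variable {G : Type v} [Group G] [TopologicalSpace G]
variable {L : Type u} [NonUnitalCStarAlgebra L]
variable {A : Type w} [NonUnitalCStarAlgebra A]
variable {H : Type u} [NormedAddCommGroup H] [InnerProductSpace ℂ H] [CompleteSpace H]

/-- `U` is an `L`-representation of `G`: it lies in the range `Rep(G, H)_η` of `η^*`. -/
def HostAlgebra.IsLRep (hL : HostAlgebra G L) (U : G →* unitary (H →L[ℂ] H)) : Prop :=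
  ∃ σ : Rep L H, etaStar hL.η σ = U

/-- `U_L = (η^*)⁻¹(U)`: the representation of `L` that belongs to an `L`-representation `U`
(unique, since `η^*` is injective). -/
noncomputable def HostAlgebra.lRep (hL : HostAlgebra G L) {U : G →* unitary (H →L[ℂ] H)}
    (hU : hL.IsLRep U) : Rep L H :=
  hU.choose

/-- `(π, U)` is a covariant representation of `(A, G, α)` on `H`. -/
structure IsCovariantRep (α : G →* (A ≃⋆ₐ[ℂ] A)) (π : A →⋆ₙₐ[ℂ] (H →L[ℂ] H))
    (U : G →* unitary (H →L[ℂ] H)) : Prop where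
  nondeg : NondegRep π
  continuous : IsStronglyContinuous U
  covariant : ∀ g a, (U g : H →L[ℂ] H) * π a * star (U g : H →L[ℂ] H) = π (α g a)

end Covariant

/-! ### Crossed product hosts -/

/-- A crossed product host `(C, η_A, η_L)` for `(α, L)`. -/
structure CrossedProductHost {G : Type v} [Group G] [TopologicalSpace G]
    {L : Type u} [NonUnitalCStarAlgebra L] (hL : HostAlgebra G L)
    {A : Type w} [NonUnitalCStarAlgebra A] (α : G →* (A ≃⋆ₐ[ℂ] A))
    (C : Type u) [NonUnitalCStarAlgebra C] where
  /-- The morphism `η_A : A → M(C)` -/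
  ηA : A →⋆ₙₐ[ℂ] 𝓜(ℂ, C)
  /-- The morphism `η_L : L → M(C)` -/
  ηL : L →⋆ₙₐ[ℂ] 𝓜(ℂ, C)
  /-- `η_L` is non-degenerate. -/
  nondeg : NondegHom ηL
  /-- Covariance: `η̃_L(η(g)) η_A(a) η̃_L(η(g))^* = η_A(α_g(a))` in `M(C)`. -/
  covariant : ∀ g a, homExt ηL nondeg (hL.η g : 𝓜(ℂ, L)) * ηA a
      * star (homExt ηL nondeg (hL.η g : 𝓜(ℂ, L))) = ηA (α g a)
  /-- `η_A(A) η_L(L) ⊆ C` -/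
  mul_mem : ∀ a l, ∃ c : C, DoubleCentralizer.coeHom (𝕜 := ℂ) c = ηA a * ηL l
  /-- `C` is generated by `η_A(A) η_L(L)` as a C⋆-algebra -/
  generates : (NonUnitalStarAlgebra.adjoin ℂ
    {c : C | ∃ a l, DoubleCentralizer.coeHom (𝕜 := ℂ) c = ηA a * ηL l}).topologicalClosure = ⊤

namespace CrossedProductHost

variable {G : Type v} [Group G] [TopologicalSpace G]
variable {L : Type u} [NonUnitalCStarAlgebra L] {hL : HostAlgebra G L}
variable {A : Type w} [NonUnitalCStarAlgebra A] {α : G →* (A ≃⋆ₐ[ℂ] A)}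
variable {C : Type u} [NonUnitalCStarAlgebra C] {D : Type u} [NonUnitalCStarAlgebra D]

/-- `η_G = η̃_L ∘ η : G → U(M(C))`. -/
noncomputable def ηG (P : CrossedProductHost hL α C) : G →* unitary 𝓜(ℂ, C) :=
  (Unitary.map (StarMonoidHom.ofClass (homExt P.ηL P.nondeg))).toMonoidHom.comp hL.η

/-- The map `η_×^* : ρ ↦ (ρ̃ ∘ η_A, ρ̃ ∘ η_G)` on `Rep(C, H)`. -/
noncomputable def etaCrossStar (P : CrossedProductHost hL α C)
    {H : Type u} [NormedAddCommGroup H] [InnerProductSpace ℂ H] [CompleteSpace H]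
    (ρ : Rep C H) : (A →⋆ₙₐ[ℂ] (H →L[ℂ] H)) × (G →* unitary (H →L[ℂ] H)) :=
  ((repExt ρ.1 ρ.2 : 𝓜(ℂ, C) →⋆ₙₐ[ℂ] (H →L[ℂ] H)).comp P.ηA, etaStar P.ηG ρ)

/-- `Rep(α, H)_{η_×}`: the range of `η_×^*`, that is, the class of covariant representations on
`H` carried by the crossed product host. -/
def carriedReps (P : CrossedProductHost hL α C)
    (H : Type u) [NormedAddCommGroup H] [InnerProductSpace ℂ H] [CompleteSpace H] :
    Set ((A →⋆ₙₐ[ℂ] (H →L[ℂ] H)) × (G →* unitary (H →L[ℂ] H))) :=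
  Set.range fun ρ : Rep C H => P.etaCrossStar ρ

/-- The crossed product host is full: every covariant `L`-representation `(π, U)` comes from a
unique representation `ρ` of `C` with `ρ(η_A(a) η_L(l)) = π(a) U_L(l)`. -/
def IsFull (P : CrossedProductHost hL α C) : Prop :=
  ∀ (H : Type u) [NormedAddCommGroup H] [InnerProductSpace ℂ H] [CompleteSpace H]
    (π : A →⋆ₙₐ[ℂ] (H →L[ℂ] H)) (U : G →* unitary (H →L[ℂ] H)),
    IsCovariantRep α π U → ∀ hU : hL.IsLRep U,
      ∃! ρ : C →⋆ₙₐ[ℂ] (H →L[ℂ] H), ∀ (a : A) (l : L) (c : C),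
        DoubleCentralizer.coeHom (𝕜 := ℂ) c = P.ηA a * P.ηL l →
          ρ c = π a * (hL.lRep hU).1 l

/-- The isomorphism `Φ : C → D` intertwines the crossed product hosts `P` and `Q`:
`Φ̃ ∘ η_A = η_A'` and `Φ̃ ∘ η_L = η_L'`. -/
def Intertwines (P : CrossedProductHost hL α C) (Q : CrossedProductHost hL α D)
    (Φ : C ≃⋆ₐ[ℂ] D) : Prop :=
  (∀ a, isoExt Φ (P.ηA a) = Q.ηA a) ∧ ∀ l, isoExt Φ (P.ηL l) = Q.ηL l

/-- Isomorphism of crossed product hosts for `(α, L)`. -/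
def Isomorphic (P : CrossedProductHost hL α C) (Q : CrossedProductHost hL α D) : Prop :=
  ∃ Φ : C ≃⋆ₐ[ℂ] D, P.Intertwines Q Φ

end CrossedProductHost

end CPHost

/-!
Call `ρ ∈ Rep(C, H)` and `σ ∈ Rep(D, H)` matching if they have the same covariant representation
`(ρ̃ ∘ η_A, ρ̃ ∘ η_G) = (σ̃ ∘ η_A', σ̃ ∘ η_G')`.  Since `ρ̃ ∘ η_G = (ρ̃ ∘ η_L)~ ∘ η` and `η^*` is
injective, matching representations also satisfy `ρ̃ ∘ η_L = σ̃ ∘ η_L'`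
(`pullback_eq_of_etaCrossStar_eq`), so `ρ(c) = σ(d)` for all pairs `(c, d)` in the C⋆-subalgebra
`graph P Q` of `C × D` generated by the pairs `(η_A(a) η_L(l), η_A'(a) η_L'(l))`.

If the two hosts carry the same covariant representations, every representation of `C` or of `D` has
a match.  The GNS representations separate points (`exists_rep_ne_zero`), so `(0, d)` or `(c, 0)` in
`graph P Q` forces `d = 0` or `c = 0`.  Thus both projections of `graph P Q` are injective, hence
isometric with closed range, and their ranges contain generators: `graph P Q` is the graph of an
isomorphism `Φ` (`exists_starAlgEquiv_of_graph`).  That `Φ` intertwines is again tested on matching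
representations; it is unique since `Φ̃` determines `Φ` on the generators `η_A(a) η_L(l)`.

A full host carries exactly the covariant representations `(π, U)` in which `U` is an
`L`-representation (`IsFull.carriedReps_eq`), so the case of two full hosts reduces to the first
statement.  The delicate point is that `ρ̃ ∘ η_A` is non-degenerate for `ρ ∈ Rep(C, H)`: its
essential projection `p` commutes with `ρ̃ ∘ η_G` by covariance; conjugation by the unitary `2 p - 1`
then fixes `ρ̃ ∘ η_G`, hence fixes `ρ̃ ∘ η_L` by injectivity of `η^*`, and so `p` is a unit for
`ρ(C)`.
-/

namespace CPHost

/-! ### Non-degenerate representations separate points -/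

section Separation

variable {D : Type u} [NonUnitalCStarAlgebra D]

open scoped ComplexOrder in
/-- A nonzero positive element is detected by a positive functional: separate `-b` from the closed
cone of positive elements. -/
lemma exists_positiveLinearMap_ne_zero [PartialOrder D] [StarOrderedRing D] {b : D} (hb : 0 ≤ b)
    (hb0 : b ≠ 0) : ∃ f : D →ₚ[ℂ] ℂ, f b ≠ 0 := by
  have hconv : Convex ℝ {a : D | 0 ≤ a} := by
    intro x hx y hy s t hs ht _
    exact add_nonneg (smul_nonneg hs hx) (smul_nonneg ht hy)
  have hmem : -b ∉ {a : D | 0 ≤ a} := fun h =>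
    hb0 (le_antisymm (neg_nonneg.mp h) hb)
  obtain ⟨f, r, hfr, hf⟩ := RCLike.geometric_hahn_banach_point_closed (𝕜 := ℂ) hconv
    CStarAlgebra.isClosed_nonneg hmem
  simp only [RCLike.re_to_complex, map_neg, Set.mem_ofPred_eq] at hfr hf
  have hr : r < 0 := by simpa using hf 0 le_rfl
  have hpos (a : D) (ha : 0 ≤ a) : 0 ≤ (f a).re := by
    by_contra! h
    -- the functional is bounded below by `r` on the cone, so it cannot be negative on a ray
    have h1 := hf ((r / (f a).re) • a) (smul_nonneg (div_nonneg_of_nonpos hr.le h.le) ha)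
    rw [← Complex.coe_smul, map_smul, smul_eq_mul, Complex.re_ofReal_mul,
      div_mul_cancel₀ _ h.ne] at h1
    exact lt_irrefl _ h1
  -- the hermitian part of `f`
  let g : D →ₗ[ℂ] ℂ :=
    { toFun a := f a + star (f (star a))
      map_add' a b := by simp only [map_add, star_add]; ring
      map_smul' c a := by
        simp only [map_smul, star_smul, smul_eq_mul, star_mul', star_star, RingHom.id_apply]; ring }
  have hg (a : D) (ha : 0 ≤ a) : g a = ((2 * (f a).re : ℝ) : ℂ) := by
    change f a + star (f (star a)) = _
    rw [(IsSelfAdjoint.of_nonneg ha).star_eq]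
    exact Complex.add_conj _
  refine ⟨PositiveLinearMap.mk₀ g fun a ha => ?_, ?_⟩
  · rw [hg a ha, Complex.zero_le_real]
    exact mul_nonneg zero_le_two (hpos a ha)
  · change g b ≠ 0
    rw [hg b hb, Complex.ofReal_ne_zero]
    have : 0 < (f b).re := by linarith
    positivity

open scoped ComplexOrder in
lemma nondegRep_gns [PartialOrder D] [StarOrderedRing D] (f : D →ₚ[ℂ] ℂ) :
    NondegRep f.gnsNonUnitalStarAlgHom := by
  have hl := CStarAlgebra.increasingApproximateUnit D
  have hf : Continuous f := map_continuous f
  -- the vectors `e • b = e b` converge to `b` in the seminorm of `f`, for an approximate unit `e`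
  have key (b : f.PreGNS) : Tendsto (fun e : D => f.leftMulMapPreGNS e b)
      (CStarAlgebra.approximateUnit D) (𝓝 b) := by
    rw [tendsto_iff_norm_sub_tendsto_zero]
    have h1 : Tendsto (fun e : D => e * f.ofPreGNS b - f.ofPreGNS b)
        (CStarAlgebra.approximateUnit D) (𝓝 0) := by
      simpa using (hl.tendsto_mul_right (f.ofPreGNS b)).sub_const (f.ofPreGNS b)
    have h2 : Continuous fun x : D => √(f (star x * x)).re := by fun_prop
    simpa [PositiveLinearMap.preGNS_norm_def, Function.comp_def] using (h2.tendsto 0).comp h1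
  intro x
  have hsub : Set.range ((↑) : f.PreGNS → f.GNS) ⊆ closure
      (Submodule.span ℂ {y : f.GNS | ∃ a z, f.gnsNonUnitalStarAlgHom a z = y} : Set f.GNS) := by
    rintro _ ⟨b, rfl⟩
    refine mem_closure_of_tendsto
      (((UniformSpace.Completion.continuous_coe f.PreGNS).tendsto b).comp (key b))
      (Eventually.of_forall fun e => Submodule.subset_span ⟨e, b, ?_⟩)
    exact PositiveLinearMap.gnsNonUnitalStarAlgHom_apply_coe f
  exact closure_minimal hsub isClosed_closure (UniformSpace.Completion.denseRange_coe x)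

/-- The GNS representations separate the points of a C⋆-algebra. -/
lemma exists_rep_ne_zero {d : D} (hd : d ≠ 0) :
    ∃ (H : Type u) (_ : NormedAddCommGroup H) (_ : InnerProductSpace ℂ H) (_ : CompleteSpace H)
      (ρ : Rep D H), ρ.1 d ≠ 0 := by
  let _ := CStarAlgebra.spectralOrder D
  let _ := CStarAlgebra.spectralOrderedRing D
  have h1 : d * star d ≠ 0 := (CStarRing.mul_star_self_eq_zero_iff d).not.mpr hd
  obtain ⟨f, hf⟩ := exists_positiveLinearMap_ne_zero (star_mul_self_nonneg (d * star d))
    ((CStarRing.star_mul_self_eq_zero_iff _).not.mpr h1)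
  refine ⟨f.GNS, inferInstance, inferInstance, inferInstance,
    ⟨f.gnsNonUnitalStarAlgHom, nondegRep_gns f⟩, fun h => hf ?_⟩
  -- `d` maps the vector of `d⋆` to that of `d d⋆`, whose norm does not vanish
  have h2 : f.gnsNonUnitalStarAlgHom d (f.toPreGNS (star d) : f.GNS)
      = (f.toPreGNS (d * star d) : f.GNS) := by simp
  rw [h, zero_apply] at h2
  have h3 : ‖f.toPreGNS (d * star d)‖ = 0 := by
    rw [← UniformSpace.Completion.norm_coe, ← h2, norm_zero]
  have h4 := f.preGNS_norm_sq (f.toPreGNS (d * star d))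
  rw [h3] at h4
  simpa using h4.symm

lemma eq_of_forall_rep {d e : D}
    (h : ∀ (H : Type u) [NormedAddCommGroup H] [InnerProductSpace ℂ H] [CompleteSpace H]
      (ρ : Rep D H), ρ.1 d = ρ.1 e) : d = e := by
  by_contra hde
  obtain ⟨H, _, _, _, ρ, hρ⟩ := exists_rep_ne_zero (sub_ne_zero.mpr hde)
  exact hρ (by rw [map_sub, h H ρ, sub_self])

end Separation

/-! ### Injective morphisms onto generating sets -/

/-- The range of an injective morphism is closed, so it is everything once it contains
generators. -/
lemma bijective_of_injective_of_generates {R C : Type*} [NonUnitalCStarAlgebra R]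
    [NonUnitalCStarAlgebra C] (f : R →⋆ₙₐ[ℂ] C) (hf : Function.Injective f) {S : Set C}
    (hS : (NonUnitalStarAlgebra.adjoin ℂ S).topologicalClosure = ⊤) (hSf : S ⊆ Set.range f) :
    Function.Bijective f := by
  refine ⟨hf, fun c => ?_⟩
  have hclosed : IsClosed (NonUnitalStarAlgHom.range f : Set C) := by
    rw [NonUnitalStarAlgHom.coe_range]
    exact (NonUnitalStarAlgHom.isometry f hf).isClosedEmbedding.isClosed_range
  have hle : (NonUnitalStarAlgebra.adjoin ℂ S).topologicalClosure ≤ NonUnitalStarAlgHom.range f :=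
    NonUnitalStarSubalgebra.topologicalClosure_minimal _
      (NonUnitalStarAlgebra.adjoin_le (by rwa [NonUnitalStarAlgHom.coe_range])) hclosed
  rw [hS] at hle
  simpa using hle (NonUnitalStarAlgebra.mem_top (x := c))

/-- Continuous morphisms that agree on a set agree on the C⋆-subalgebra it generates. -/
lemma eqOn_topologicalClosure_adjoin {C B : Type*} [NonUnitalCStarAlgebra C]
    [NonUnitalSemiring B] [StarRing B] [Module ℂ B] [TopologicalSpace B] [T2Space B]
    {f g : C →⋆ₙₐ[ℂ] B} (hf : Continuous f) (hg : Continuous g) {S : Set C} (h : Set.EqOn f g S) :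
    ∀ c ∈ (NonUnitalStarAlgebra.adjoin ℂ S).topologicalClosure, f c = g c := by
  have hle : (NonUnitalStarAlgebra.adjoin ℂ S).topologicalClosure
      ≤ NonUnitalStarAlgHom.equalizer f g :=
    NonUnitalStarSubalgebra.topologicalClosure_minimal _ (NonUnitalStarAlgebra.adjoin_le h)
      (isClosed_eq hf hg)
  exact fun c hc => hle hc

/-- A closed ⋆-subalgebra `R` of `C × D` that meets `C × 0` and `0 × D` trivially, and whose
projections to `C` and to `D` contain generators, is the graph of an isomorphism `C ≅ D`. -/
lemma exists_starAlgEquiv_of_graph {C D : Type*} [NonUnitalCStarAlgebra C]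
    [NonUnitalCStarAlgebra D] (R : NonUnitalStarSubalgebra ℂ (C × D))
    (hR : IsClosed (R : Set (C × D)))
    (h₁ : ∀ d, ((0 : C), d) ∈ R → d = 0) (h₂ : ∀ c, (c, (0 : D)) ∈ R → c = 0)
    {S : Set C} (hS : (NonUnitalStarAlgebra.adjoin ℂ S).topologicalClosure = ⊤)
    (hSR : ∀ c ∈ S, ∃ d, (c, d) ∈ R)
    {T : Set D} (hT : (NonUnitalStarAlgebra.adjoin ℂ T).topologicalClosure = ⊤)
    (hTR : ∀ d ∈ T, ∃ c, (c, d) ∈ R) :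
    ∃ Φ : C ≃⋆ₐ[ℂ] D, ∀ c, (c, Φ c) ∈ R := by
  have := hR
  let p : R →⋆ₙₐ[ℂ] C := (NonUnitalStarAlgHom.fst ℂ C D).comp
    (NonUnitalStarSubalgebraClass.subtype R)
  let q : R →⋆ₙₐ[ℂ] D := (NonUnitalStarAlgHom.snd ℂ C D).comp
    (NonUnitalStarSubalgebraClass.subtype R)
  have hp : Function.Injective p := by
    rw [injective_iff_map_eq_zero]
    rintro ⟨⟨c, d⟩, hcd⟩ (rfl : c = 0)
    obtain rfl := h₁ d hcd
    rfl
  have hq : Function.Injective q := by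
    rw [injective_iff_map_eq_zero]
    rintro ⟨⟨c, d⟩, hcd⟩ (rfl : d = 0)
    obtain rfl := h₂ c hcd
    rfl
  have hp' := bijective_of_injective_of_generates p hp hS fun c hc => by
    obtain ⟨d, hd⟩ := hSR c hc
    exact ⟨⟨_, hd⟩, rfl⟩
  have hq' := bijective_of_injective_of_generates q hq hT fun d hd => by
    obtain ⟨c, hc⟩ := hTR d hd
    exact ⟨⟨_, hc⟩, rfl⟩
  refine ⟨(StarAlgEquiv.ofBijective p hp').symm.trans (StarAlgEquiv.ofBijective q hq'),
    fun c => ?_⟩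
  obtain ⟨r, rfl⟩ := hp'.surjective c
  have hr : (StarAlgEquiv.ofBijective p hp').symm (p r) = r :=
    (StarAlgEquiv.ofBijective p hp').symm_apply_apply r
  rw [StarAlgEquiv.trans_apply, hr]
  exact r.2

/-! ### Representations of multipliers -/

section Multipliers

variable {L C D : Type*} [NonUnitalCStarAlgebra L] [NonUnitalCStarAlgebra C]
  [NonUnitalCStarAlgebra D]
variable {H : Type*} [NormedAddCommGroup H] [InnerProductSpace ℂ H] [CompleteSpace H]

lemma coeHom_injective :
    Function.Injective (DoubleCentralizer.coeHom (𝕜 := ℂ) : C →⋆ₙₐ[ℂ] 𝓜(ℂ, C)) := by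
  refine (injective_iff_map_eq_zero _).mpr fun c hc => ?_
  rw [← CStarRing.mul_star_self_eq_zero_iff]
  exact congrArg (fun m : 𝓜(ℂ, C) => m.fst (star c)) hc

lemma mul_coeHom (m : 𝓜(ℂ, C)) (c : C) :
    m * DoubleCentralizer.coeHom (𝕜 := ℂ) c = DoubleCentralizer.coeHom (𝕜 := ℂ) (m.fst c) :=
  ext_fst <| by
    ext x
    simp [fst_mul]

lemma continuous_rep (π : C →⋆ₙₐ[ℂ] (H →L[ℂ] H)) : Continuous π :=
  AddMonoidHomClass.continuous_of_bound π 1 fun c => by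
    simpa using NonUnitalStarAlgHom.norm_apply_le π c

lemma repExt_mul_apply (ρ : Rep C H) (m : 𝓜(ℂ, C)) (c : C) :
    repExt ρ.1 ρ.2 m * ρ.1 c = ρ.1 (m.fst c) := by
  rw [← repExt_coe ρ.1 ρ.2 c, ← map_mul, mul_coeHom, repExt_coe]

/-- The representation `ρ̃ ∘ φ` of `L`, for a representation `ρ` of `C` and a non-degenerate
morphism `φ : L → M(C)`. -/
noncomputable def Rep.pullback (ρ : Rep C H) (φ : L →⋆ₙₐ[ℂ] 𝓜(ℂ, C)) (hφ : NondegHom φ) :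
    Rep L H where
  val := (repExt ρ.1 ρ.2 : 𝓜(ℂ, C) →⋆ₙₐ[ℂ] (H →L[ℂ] H)).comp φ
  property := by
    set K := Submodule.span ℂ
      {y : H | ∃ l x, (repExt ρ.1 ρ.2 : 𝓜(ℂ, C) →⋆ₙₐ[ℂ] (H →L[ℂ] H)).comp φ l x = y}
    have hmem (c : C) (x : H) : ρ.1 c x ∈ K.topologicalClosure := by
      have hcont : Continuous fun c : C => ρ.1 c x :=
        (continuous_rep ρ.1).clm_apply continuous_const
      let ev : C →ₗ[ℂ] H :=
        { toFun c := ρ.1 c x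
          map_add' := by simp
          map_smul' := by simp }
      have hle : Submodule.span ℂ {y : C | ∃ l c, (φ l).fst c = y}
          ≤ K.topologicalClosure.comap ev := by
        rw [Submodule.span_le]
        rintro _ ⟨l, c, rfl⟩
        refine Submodule.le_topologicalClosure _ (Submodule.subset_span ⟨l, ρ.1 c x, ?_⟩)
        exact congrArg (fun T : H →L[ℂ] H => T x) (repExt_mul_apply ρ (φ l) c)
      exact closure_minimal hle (K.isClosed_topologicalClosure.preimage hcont) (hφ c)
    intro y
    refine closure_minimal (s := (Submodule.span ℂ {y : H | ∃ c x, ρ.1 c x = y} : Set H)) ?_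
      isClosed_closure (ρ.2 y)
    change Submodule.span ℂ _ ≤ K.topologicalClosure
    rw [Submodule.span_le]
    rintro _ ⟨c, x, rfl⟩
    exact hmem c x

lemma repExt_pullback (ρ : Rep C H) (φ : L →⋆ₙₐ[ℂ] 𝓜(ℂ, C)) (hφ : NondegHom φ) (m : 𝓜(ℂ, L)) :
    repExt (ρ.pullback φ hφ).1 (ρ.pullback φ hφ).2 m = repExt ρ.1 ρ.2 (homExt φ hφ m) := by
  refine NondegAction.ext (ρ.pullback φ hφ).2 fun l x => ?_
  refine (congrArg (fun T : H →L[ℂ] H => T x) (repExt_mul_apply (ρ.pullback φ hφ) m l)).trans ?_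
  change repExt ρ.1 ρ.2 (φ (m.fst l)) x = (repExt ρ.1 ρ.2 (homExt φ hφ m) * repExt ρ.1 ρ.2 (φ l)) x
  rw [← map_mul, ← homExt_coe φ hφ l, ← map_mul, mul_coeHom, homExt_coe]

lemma isoExt_coe (Φ : C ≃⋆ₐ[ℂ] D) (c : C) :
    isoExt Φ (DoubleCentralizer.coeHom (𝕜 := ℂ) c) = DoubleCentralizer.coeHom (𝕜 := ℂ) (Φ c) :=
  homExt_coe (isoHom Φ) (isoHom_nondeg Φ) c

lemma isoExt_fst_apply (Φ : C ≃⋆ₐ[ℂ] D) (m : 𝓜(ℂ, C)) (c : C) :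
    (isoExt Φ m).fst (Φ c) = Φ (m.fst c) := by
  apply coeHom_injective
  rw [← mul_coeHom, ← isoExt_coe, ← map_mul, mul_coeHom, isoExt_coe]

end Multipliers

section EtaStar

variable {G : Type*} [Group G] {L : Type*} [NonUnitalCStarAlgebra L]
variable {H : Type*} [NormedAddCommGroup H] [InnerProductSpace ℂ H] [CompleteSpace H]

lemma coe_etaStar (η : G →* unitary 𝓜(ℂ, L)) (π : Rep L H) (g : G) :
    (etaStar η π g : H →L[ℂ] H) = repExt π.1 π.2 (η g : 𝓜(ℂ, L)) := rfl

end EtaStar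

namespace CrossedProductHost

variable {G : Type v} [Group G] [TopologicalSpace G]
variable {L : Type u} [NonUnitalCStarAlgebra L] {hL : HostAlgebra G L}
variable {A : Type w} [NonUnitalCStarAlgebra A] {α : G →* (A ≃⋆ₐ[ℂ] A)}
variable {C : Type u} [NonUnitalCStarAlgebra C] {D : Type u} [NonUnitalCStarAlgebra D]
variable {H : Type u} [NormedAddCommGroup H] [InnerProductSpace ℂ H] [CompleteSpace H]

lemma coe_ηG (P : CrossedProductHost hL α C) (g : G) :
    (P.ηG g : 𝓜(ℂ, C)) = homExt P.ηL P.nondeg (hL.η g : 𝓜(ℂ, L)) := rfl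

/-- `(ρ̃ ∘ η_L)~ ∘ η = ρ̃ ∘ η_G`. -/
lemma etaStar_pullback (P : CrossedProductHost hL α C) (ρ : Rep C H) :
    etaStar hL.η (ρ.pullback P.ηL P.nondeg) = etaStar P.ηG ρ := by
  ext g : 2
  rw [coe_etaStar, coe_etaStar, repExt_pullback, coe_ηG]

lemma etaCrossStar_fst_apply (P : CrossedProductHost hL α C) (ρ : Rep C H) (a : A) :
    (P.etaCrossStar ρ).1 a = repExt ρ.1 ρ.2 (P.ηA a) := rfl

lemma pullback_apply (P : CrossedProductHost hL α C) (ρ : Rep C H) (l : L) :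
    (ρ.pullback P.ηL P.nondeg).1 l = repExt ρ.1 ρ.2 (P.ηL l) := rfl

lemma rep_apply_of_coe_eq_mul (P : CrossedProductHost hL α C) (ρ : Rep C H) {a : A} {l : L} {c : C}
    (hc : DoubleCentralizer.coeHom (𝕜 := ℂ) c = P.ηA a * P.ηL l) :
    ρ.1 c = (P.etaCrossStar ρ).1 a * (ρ.pullback P.ηL P.nondeg).1 l := by
  rw [← repExt_coe ρ.1 ρ.2 c, hc, map_mul, etaCrossStar_fst_apply, pullback_apply]

/-- The `G`-part of a representation of a crossed product host determines its `L`-part, because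
`η^*` is injective. -/
lemma pullback_eq_of_etaCrossStar_eq {P : CrossedProductHost hL α C} {Q : CrossedProductHost hL α D}
    {ρ : Rep C H} {σ : Rep D H} (h : P.etaCrossStar ρ = Q.etaCrossStar σ) :
    ρ.pullback P.ηL P.nondeg = σ.pullback Q.ηL Q.nondeg := by
  apply hL.injective H
  rw [etaStar_pullback, etaStar_pullback]
  exact congrArg Prod.snd h

end CrossedProductHost

/-! ### Uniqueness of crossed product hosts -/

namespace CrossedProductHost

variable {G : Type v} [Group G] [TopologicalSpace G]
variable {L : Type u} [NonUnitalCStarAlgebra L] {hL : HostAlgebra G L}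
variable {A : Type w} [NonUnitalCStarAlgebra A] {α : G →* (A ≃⋆ₐ[ℂ] A)}
variable {C : Type u} [NonUnitalCStarAlgebra C] {D : Type u} [NonUnitalCStarAlgebra D]
variable {H : Type u} [NormedAddCommGroup H] [InnerProductSpace ℂ H] [CompleteSpace H]

/-- The C⋆-subalgebra of `C × D` generated by the pairs
`(η_A(a) η_L(l), η_A'(a) η_L'(l))`. -/
noncomputable def graph (P : CrossedProductHost hL α C) (Q : CrossedProductHost hL α D) :
    NonUnitalStarSubalgebra ℂ (C × D) :=
  (NonUnitalStarAlgebra.adjoin ℂ {p : C × D | ∃ a l,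
    DoubleCentralizer.coeHom (𝕜 := ℂ) p.1 = P.ηA a * P.ηL l ∧
    DoubleCentralizer.coeHom (𝕜 := ℂ) p.2 = Q.ηA a * Q.ηL l}).topologicalClosure

/-- Representations of `C` and of `D` with the same covariant representation agree along
`graph P Q`. -/
lemma rep_eq_of_mem_graph {P : CrossedProductHost hL α C} {Q : CrossedProductHost hL α D}
    {ρ : Rep C H} {σ : Rep D H} (h : P.etaCrossStar ρ = Q.etaCrossStar σ)
    {p : C × D} (hp : p ∈ graph P Q) : ρ.1 p.1 = σ.1 p.2 := by
  refine eqOn_topologicalClosure_adjoin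
    (f := ρ.1.comp (NonUnitalStarAlgHom.fst ℂ C D))
    (g := σ.1.comp (NonUnitalStarAlgHom.snd ℂ C D))
    ((continuous_rep ρ.1).comp continuous_fst) ((continuous_rep σ.1).comp continuous_snd) ?_ p hp
  rintro ⟨c, d⟩ ⟨a, l, hc, hd⟩
  change ρ.1 c = σ.1 d
  rw [rep_apply_of_coe_eq_mul P ρ hc, rep_apply_of_coe_eq_mul Q σ hd, h,
    pullback_eq_of_etaCrossStar_eq h]

lemma exists_etaCrossStar_eq {P : CrossedProductHost hL α C} {Q : CrossedProductHost hL α D}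
    (h : P.carriedReps H = Q.carriedReps H) (ρ : Rep C H) :
    ∃ σ : Rep D H, P.etaCrossStar ρ = Q.etaCrossStar σ := by
  have h1 : P.etaCrossStar ρ ∈ Q.carriedReps H := h ▸ Set.mem_range_self ρ
  obtain ⟨σ, hσ⟩ := h1
  exact ⟨σ, hσ.symm⟩

/-- An isomorphism whose graph lies in `graph P Q` intertwines `P` and `Q`. -/
lemma intertwines_of_mem_graph {P : CrossedProductHost hL α C} {Q : CrossedProductHost hL α D}
    (h : ∀ (H : Type u) [NormedAddCommGroup H] [InnerProductSpace ℂ H] [CompleteSpace H],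
      P.carriedReps H = Q.carriedReps H) {Φ : C ≃⋆ₐ[ℂ] D} (hΦ : ∀ c, (c, Φ c) ∈ graph P Q) :
    P.Intertwines Q Φ := by
  -- multipliers `m`, `n` with `ρ̃(m) = σ̃(n)` for all corresponding `ρ`, `σ` are related by `Φ̃`
  have key {m : 𝓜(ℂ, C)} {n : 𝓜(ℂ, D)}
      (hmn : ∀ (H : Type u) [NormedAddCommGroup H] [InnerProductSpace ℂ H] [CompleteSpace H]
        (ρ : Rep C H) (σ : Rep D H), P.etaCrossStar ρ = Q.etaCrossStar σ →
          repExt ρ.1 ρ.2 m = repExt σ.1 σ.2 n) : isoExt Φ m = n := by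
    refine ext_fst ?_
    ext d
    obtain ⟨c, rfl⟩ := EquivLike.surjective Φ d
    rw [isoExt_fst_apply]
    refine eq_of_forall_rep fun H _ _ _ σ => ?_
    obtain ⟨ρ, hρ⟩ := exists_etaCrossStar_eq (h H).symm σ
    have hρσ (c : C) : ρ.1 c = σ.1 (Φ c) := rep_eq_of_mem_graph hρ.symm (hΦ c)
    rw [← hρσ, ← repExt_mul_apply, ← repExt_mul_apply, hρσ, hmn H ρ σ hρ.symm]
  refine ⟨fun a => key fun H _ _ _ ρ σ hρσ => ?_, fun l => key fun H _ _ _ ρ σ hρσ => ?_⟩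
  · rw [← etaCrossStar_fst_apply, ← etaCrossStar_fst_apply, hρσ]
  · rw [← pullback_apply, ← pullback_apply, pullback_eq_of_etaCrossStar_eq hρσ]

lemma Intertwines.eq {P : CrossedProductHost hL α C} {Q : CrossedProductHost hL α D}
    {Φ Ψ : C ≃⋆ₐ[ℂ] D} (hΦ : P.Intertwines Q Φ) (hΨ : P.Intertwines Q Ψ) : Φ = Ψ := by
  ext c
  refine eqOn_topologicalClosure_adjoin (f := (Φ : C →⋆ₙₐ[ℂ] D)) (g := (Ψ : C →⋆ₙₐ[ℂ] D))
    (NonUnitalStarAlgHom.isometry Φ (EquivLike.injective Φ)).continuous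
    (NonUnitalStarAlgHom.isometry Ψ (EquivLike.injective Ψ)).continuous ?_ c
    (P.generates ▸ NonUnitalStarAlgebra.mem_top)
  rintro c ⟨a, l, hc⟩
  apply coeHom_injective
  change DoubleCentralizer.coeHom (𝕜 := ℂ) (Φ c) = DoubleCentralizer.coeHom (𝕜 := ℂ) (Ψ c)
  rw [← isoExt_coe, ← isoExt_coe, hc, map_mul, map_mul, hΦ.1, hΦ.2, hΨ.1, hΨ.2]

/-- Crossed product hosts carrying the same covariant representations are isomorphic, by a unique
intertwining isomorphism. -/
theorem existsUnique_intertwines {P : CrossedProductHost hL α C} {Q : CrossedProductHost hL α D}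
    (h : ∀ (H : Type u) [NormedAddCommGroup H] [InnerProductSpace ℂ H] [CompleteSpace H],
      P.carriedReps H = Q.carriedReps H) : ∃! Φ : C ≃⋆ₐ[ℂ] D, P.Intertwines Q Φ := by
  obtain ⟨Φ, hΦ⟩ := exists_starAlgEquiv_of_graph (graph P Q)
    (NonUnitalStarSubalgebra.isClosed_topologicalClosure _)
    (fun d hd => eq_of_forall_rep fun H _ _ _ σ => by
      obtain ⟨ρ, hρ⟩ := exists_etaCrossStar_eq (h H).symm σ
      simpa using (rep_eq_of_mem_graph hρ.symm hd).symm)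
    (fun c hc => eq_of_forall_rep fun H _ _ _ ρ => by
      obtain ⟨σ, hσ⟩ := exists_etaCrossStar_eq (h H) ρ
      simpa using rep_eq_of_mem_graph hσ hc)
    P.generates
    (by
      rintro c ⟨a, l, hc⟩
      obtain ⟨d, hd⟩ := Q.mul_mem a l
      exact ⟨d, NonUnitalStarSubalgebra.le_topologicalClosure _
        (NonUnitalStarAlgebra.subset_adjoin ℂ _ ⟨a, l, hc, hd⟩)⟩)
    Q.generates
    (by
      rintro d ⟨a, l, hd⟩
      obtain ⟨c, hc⟩ := P.mul_mem a l
      exact ⟨c, NonUnitalStarSubalgebra.le_topologicalClosure _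
        (NonUnitalStarAlgebra.subset_adjoin ℂ _ ⟨a, l, hc, hd⟩)⟩)
  exact ⟨Φ, intertwines_of_mem_graph h hΦ,
    fun Ψ hΨ => hΨ.eq (intertwines_of_mem_graph h hΦ)⟩

end CrossedProductHost

/-! ### Unitaries commuting with an `L`-representation -/

section Conj

variable {L : Type*} [NonUnitalCStarAlgebra L]
variable {H : Type*} [NormedAddCommGroup H] [InnerProductSpace ℂ H] [CompleteSpace H]

/-- The representation `l ↦ V σ(l) V^*`, for a unitary `V`. -/
noncomputable def Rep.conj (σ : Rep L H) (V : unitary (H →L[ℂ] H)) : Rep L H where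
  val :=
    { toFun l := (V : H →L[ℂ] H) * σ.1 l * star (V : H →L[ℂ] H)
      map_smul' c l := by
        rw [map_smul, mul_smul_comm, smul_mul_assoc]; rfl
      map_zero' := by rw [map_zero, mul_zero, zero_mul]
      map_add' l m := by rw [map_add, mul_add, add_mul]
      map_mul' l m := by
        have hV : star (V : H →L[ℂ] H) * (V : H →L[ℂ] H) = 1 := Unitary.star_mul_self_of_mem V.2
        simp only [map_mul, mul_assoc]
        rw [← mul_assoc (star (V : H →L[ℂ] H)) (V : H →L[ℂ] H), hV, one_mul]
      map_star' l := by simp only [map_star, star_mul, star_star, mul_assoc] }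
  property := by
    intro y
    have hVV : (V : H →L[ℂ] H) (star (V : H →L[ℂ] H) y) = y :=
      congrArg (fun T : H →L[ℂ] H => T y) (Unitary.mul_star_self_of_mem V.2)
    have hy := image_closure_subset_closure_image (V : H →L[ℂ] H).continuous
      (Set.mem_image_of_mem _ (σ.2 (star (V : H →L[ℂ] H) y)))
    rw [hVV] at hy
    refine closure_mono ?_ hy
    rintro _ ⟨z, hz, rfl⟩
    induction hz using Submodule.span_induction with
    | mem z hz =>
      obtain ⟨l, x, rfl⟩ := hz
      refine Submodule.subset_span ⟨l, (V : H →L[ℂ] H) x, ?_⟩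
      have hx : star (V : H →L[ℂ] H) ((V : H →L[ℂ] H) x) = x :=
        congrArg (fun T : H →L[ℂ] H => T x) (Unitary.star_mul_self_of_mem V.2)
      change (V : H →L[ℂ] H) (σ.1 l (star (V : H →L[ℂ] H) ((V : H →L[ℂ] H) x))) = _
      rw [hx]
    | zero => exact Set.mem_of_eq_of_mem (map_zero _) (Submodule.zero_mem _)
    | add x y _ _ hx hy => exact Set.mem_of_eq_of_mem (map_add _ x y) (Submodule.add_mem _ hx hy)
    | smul c x _ hx => exact Set.mem_of_eq_of_mem (map_smul _ c x) (Submodule.smul_mem _ c hx)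

lemma Rep.conj_apply (σ : Rep L H) (V : unitary (H →L[ℂ] H)) (l : L) :
    (σ.conj V).1 l = (V : H →L[ℂ] H) * σ.1 l * star (V : H →L[ℂ] H) := rfl

lemma repExt_conj (σ : Rep L H) (V : unitary (H →L[ℂ] H)) (m : 𝓜(ℂ, L)) :
    repExt (σ.conj V).1 (σ.conj V).2 m
      = (V : H →L[ℂ] H) * repExt σ.1 σ.2 m * star (V : H →L[ℂ] H) := by
  refine NondegAction.ext (σ.conj V).2 fun l x => ?_
  refine congrArg (fun T : H →L[ℂ] H => T x) (?_ : repExt (σ.conj V).1 (σ.conj V).2 m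
    * (σ.conj V).1 l = ((V : H →L[ℂ] H) * repExt σ.1 σ.2 m * star (V : H →L[ℂ] H))
      * (σ.conj V).1 l)
  rw [repExt_mul_apply, Rep.conj_apply, Rep.conj_apply, ← repExt_mul_apply]
  simp only [mul_assoc]
  rw [← mul_assoc (star (V : H →L[ℂ] H)) (V : H →L[ℂ] H), Unitary.star_mul_self_of_mem V.2, one_mul]

end Conj

/-- A unitary that commutes with `σ̃ ∘ η` commutes with `σ`: conjugating `σ` by it does not change
`σ̃ ∘ η`, and `η^*` is injective. -/
lemma HostAlgebra.commute_of_commute_etaStar {G : Type v} [Group G] [TopologicalSpace G]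
    {L : Type u} [NonUnitalCStarAlgebra L] (hL : HostAlgebra G L)
    {H : Type u} [NormedAddCommGroup H] [InnerProductSpace ℂ H] [CompleteSpace H]
    (σ : Rep L H) (V : unitary (H →L[ℂ] H))
    (hV : ∀ g, Commute (V : H →L[ℂ] H) (etaStar hL.η σ g : H →L[ℂ] H)) (l : L) :
    Commute (V : H →L[ℂ] H) (σ.1 l) := by
  have h : σ.conj V = σ := by
    apply hL.injective H
    ext g : 2
    rw [coe_etaStar, repExt_conj, ← coe_etaStar, (hV g).eq, mul_assoc,
      Unitary.mul_star_self_of_mem V.2, mul_one]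
  have h1 : (V : H →L[ℂ] H) * σ.1 l * star (V : H →L[ℂ] H) = σ.1 l := by
    rw [← Rep.conj_apply, h]
  change _ * _ = _ * _
  nth_rw 2 [← h1]
  rw [mul_assoc, Unitary.star_mul_self_of_mem V.2, mul_one]

/-- The projection version of `HostAlgebra.commute_of_commute_etaStar`, by way of the unitary
`2 p - 1`. -/
lemma HostAlgebra.commute_of_isStarProjection {G : Type v} [Group G] [TopologicalSpace G]
    {L : Type u} [NonUnitalCStarAlgebra L] (hL : HostAlgebra G L)
    {H : Type u} [NormedAddCommGroup H] [InnerProductSpace ℂ H] [CompleteSpace H]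
    (σ : Rep L H) {p : H →L[ℂ] H} (hp : IsStarProjection p)
    (hV : ∀ g, Commute p (etaStar hL.η σ g : H →L[ℂ] H)) (l : L) :
    Commute p (σ.1 l) := by
  have hpp : p * p = p := hp.isIdempotentElem
  have hst : star p = p := hp.isSelfAdjoint
  have hsq : (2 * p - 1) * (2 * p - 1) = 1 := by
    have : (2 * p - 1) * (2 * p - 1) = 4 * (p * p) - 4 * p + 1 := by noncomm_ring
    rw [this, hpp]; simp
  have hself : star (2 * p - 1) = 2 * p - 1 := by
    rw [two_mul, star_sub, star_add, hst, star_one]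
  have hmem : 2 * p - 1 ∈ unitary (H →L[ℂ] H) := by
    rw [Unitary.mem_iff, hself]
    exact ⟨hsq, hsq⟩
  have h := hL.commute_of_commute_etaStar σ ⟨2 * p - 1, hmem⟩
    (fun g => (((Commute.ofNat_left _ _).mul_left (hV g)).sub_left (Commute.one_left _))) l
  have hp2 : p = (2⁻¹ : ℂ) • ((2 * p - 1) + 1) := by
    rw [sub_add_cancel, two_mul, ← two_smul ℂ p, smul_smul]
    norm_num
  rw [hp2]
  exact (h.add_left (Commute.one_left _)).smul_left _

/-- The projection onto the closure of `span π(A) H`, for a covariant pair `(π, U)`. -/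
lemma exists_essentialProjection {G : Type*} [Group G] {A : Type*} [NonUnitalCStarAlgebra A]
    {α : G →* (A ≃⋆ₐ[ℂ] A)}
    {H : Type*} [NormedAddCommGroup H] [InnerProductSpace ℂ H] [CompleteSpace H]
    {π : A →⋆ₙₐ[ℂ] (H →L[ℂ] H)} {U : G →* unitary (H →L[ℂ] H)}
    (h : ∀ g a, (U g : H →L[ℂ] H) * π a * star (U g : H →L[ℂ] H) = π (α g a)) :
    ∃ p : H →L[ℂ] H, IsStarProjection p ∧ (∀ a, p * π a = π a) ∧
      (∀ g, Commute p (U g : H →L[ℂ] H)) ∧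
      ∀ x, p x ∈ (Submodule.span ℂ {y : H | ∃ a x, π a x = y}).topologicalClosure := by
  set K := (Submodule.span ℂ {y : H | ∃ a x, π a x = y}).topologicalClosure
  have : CompleteSpace K := (Submodule.isClosed_topologicalClosure _).completeSpace_coe
  have hproj : IsStarProjection K.starProjection := isStarProjection_starProjection
  have hst : star K.starProjection = K.starProjection := hproj.isSelfAdjoint
  have hmem (a : A) (x : H) : π a x ∈ K :=
    Submodule.le_topologicalClosure _ (Submodule.subset_span ⟨a, x, rfl⟩)
  have hcov (g : G) (a : A) : (U g : H →L[ℂ] H) * π a = π (α g a) * (U g : H →L[ℂ] H) := by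
    rw [← h g a, mul_assoc _ (star _), Unitary.star_mul_self_of_mem (U g).2, mul_one]
  have hUK (g : G) {x : H} (hx : x ∈ K) : (U g : H →L[ℂ] H) x ∈ K := by
    refine closure_minimal (t := (U g : H →L[ℂ] H) ⁻¹' K) ?_
      ((Submodule.isClosed_topologicalClosure _).preimage (U g : H →L[ℂ] H).continuous) hx
    change Submodule.span ℂ _ ≤ K.comap ((U g : H →L[ℂ] H) : H →ₗ[ℂ] H)
    rw [Submodule.span_le]
    rintro _ ⟨a, y, rfl⟩
    have hy : (U g : H →L[ℂ] H) (π a y) = π (α g a) ((U g : H →L[ℂ] H) y) :=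
      congrArg (fun T : H →L[ℂ] H => T y) (hcov g a)
    change (U g : H →L[ℂ] H) (π a y) ∈ K
    rw [hy]
    exact hmem _ _
  have hpU (g : G) : K.starProjection * (U g : H →L[ℂ] H) * K.starProjection
      = (U g : H →L[ℂ] H) * K.starProjection := by
    ext x
    exact Submodule.starProjection_eq_self_iff.mpr (hUK g (Submodule.starProjection_apply_mem K x))
  refine ⟨K.starProjection, hproj, fun a => ?_, fun g => ?_,
    fun x => Submodule.starProjection_apply_mem K x⟩
  · ext x
    exact Submodule.starProjection_eq_self_iff.mpr (hmem a x)
  · -- `K` is also invariant under `U(g)⁻¹ = U(g)^*`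
    have h1 := congrArg star (hpU g⁻¹)
    have h2 : star (U g⁻¹ : H →L[ℂ] H) = U g := by
      rw [map_inv, ← Unitary.star_eq_inv, Unitary.coe_star, star_star]
    simp only [star_mul, hst, h2] at h1
    change _ * _ = _ * _
    rw [← hpU g, mul_assoc, h1]

namespace CrossedProductHost

variable {G : Type v} [Group G] [TopologicalSpace G]
variable {L : Type u} [NonUnitalCStarAlgebra L] {hL : HostAlgebra G L}
variable {A : Type w} [NonUnitalCStarAlgebra A] {α : G →* (A ≃⋆ₐ[ℂ] A)}
variable {C : Type u} [NonUnitalCStarAlgebra C]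
variable {H : Type u} [NormedAddCommGroup H] [InnerProductSpace ℂ H] [CompleteSpace H]

/-! ### Full crossed product hosts carry all covariant `L`-representations -/

lemma etaCrossStar_covariant (P : CrossedProductHost hL α C) (ρ : Rep C H) (g : G) (a : A) :
    ((P.etaCrossStar ρ).2 g : H →L[ℂ] H) * (P.etaCrossStar ρ).1 a
      * star ((P.etaCrossStar ρ).2 g : H →L[ℂ] H) = (P.etaCrossStar ρ).1 (α g a) := by
  change repExt ρ.1 ρ.2 (P.ηG g : 𝓜(ℂ, C)) * repExt ρ.1 ρ.2 (P.ηA a)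
    * star (repExt ρ.1 ρ.2 (P.ηG g : 𝓜(ℂ, C))) = repExt ρ.1 ρ.2 (P.ηA (α g a))
  rw [← P.covariant g a, map_mul, map_mul, map_star, coe_ηG]

/-- The essential projection of `ρ̃ ∘ η_A` commutes with `ρ̃ ∘ η_G` by covariance, hence with
`ρ̃ ∘ η_L`, so it acts as the identity on `ρ(C) H`. -/
lemma nondegRep_etaCrossStar_fst (P : CrossedProductHost hL α C) (ρ : Rep C H) :
    NondegRep (P.etaCrossStar ρ).1 := by
  obtain ⟨p, hproj, hpπ, hpU, hrange⟩ := exists_essentialProjection (P.etaCrossStar_covariant ρ)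
  have hst : star p = p := hproj.isSelfAdjoint
  have hπp (a : A) : (P.etaCrossStar ρ).1 a * p = (P.etaCrossStar ρ).1 a := by
    have h := congrArg star (hpπ (star a))
    rwa [star_mul, hst, map_star, star_star] at h
  have hpσ (l : L) : Commute p ((ρ.pullback P.ηL P.nondeg).1 l) := by
    refine hL.commute_of_isStarProjection _ hproj (fun g => ?_) l
    rw [etaStar_pullback]
    exact hpU g
  -- the `c` with `ρ(c) = p ρ(c) = ρ(c) p` form a C⋆-algebra that contains the generators
  let S : NonUnitalStarSubalgebra ℂ C :=
    { carrier := {c | p * ρ.1 c = ρ.1 c ∧ ρ.1 c * p = ρ.1 c}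
      add_mem' := by
        rintro a b ⟨ha, ha'⟩ ⟨hb, hb'⟩
        exact ⟨by rw [map_add, mul_add, ha, hb], by rw [map_add, add_mul, ha', hb']⟩
      zero_mem' := by simp
      mul_mem' := by
        rintro a b ⟨ha, ha'⟩ ⟨hb, hb'⟩
        exact ⟨by rw [map_mul, ← mul_assoc, ha], by rw [map_mul, mul_assoc, hb']⟩
      smul_mem' := by
        rintro z a ⟨ha, ha'⟩
        exact ⟨by rw [map_smul, mul_smul_comm, ha], by rw [map_smul, smul_mul_assoc, ha']⟩
      star_mem' := by
        rintro a ⟨ha, ha'⟩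
        refine ⟨?_, ?_⟩
        · have h := congrArg star ha'
          rwa [star_mul, hst, ← map_star] at h
        · have h := congrArg star ha
          rwa [star_mul, hst, ← map_star] at h }
  have hS : (⊤ : NonUnitalStarSubalgebra ℂ C) ≤ S := by
    rw [← P.generates]
    refine NonUnitalStarSubalgebra.topologicalClosure_minimal _
      (NonUnitalStarAlgebra.adjoin_le ?_) ?_
    · rintro c ⟨a, l, hc⟩
      have hρ := P.rep_apply_of_coe_eq_mul ρ hc
      refine ⟨?_, ?_⟩
      · rw [hρ, ← mul_assoc, hpπ]
      · rw [hρ, mul_assoc, ← (hpσ l).eq, ← mul_assoc, hπp]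
    · have hc := continuous_rep ρ.1
      exact (isClosed_eq (continuous_const.mul hc) hc).inter
        (isClosed_eq (hc.mul continuous_const) hc)
  intro y
  set K := (Submodule.span ℂ {y : H | ∃ a x, (P.etaCrossStar ρ).1 a x = y}).topologicalClosure
  refine closure_minimal (t := (K : Set H)) ?_ (Submodule.isClosed_topologicalClosure _) (ρ.2 y)
  change Submodule.span ℂ _ ≤ K
  rw [Submodule.span_le]
  rintro _ ⟨c, x, rfl⟩
  have h1 : p (ρ.1 c x) = ρ.1 c x :=
    congrArg (fun T : H →L[ℂ] H => T x) (hS (NonUnitalStarAlgebra.mem_top (x := c))).1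
  exact Set.mem_of_eq_of_mem h1.symm (hrange (ρ.1 c x))

lemma isCovariantRep_etaCrossStar (P : CrossedProductHost hL α C) (ρ : Rep C H) :
    IsCovariantRep α (P.etaCrossStar ρ).1 (P.etaCrossStar ρ).2 where
  nondeg := P.nondegRep_etaCrossStar_fst ρ
  continuous := by
    change IsStronglyContinuous (etaStar P.ηG ρ)
    rw [← etaStar_pullback]
    exact hL.continuous H _
  covariant := P.etaCrossStar_covariant ρ

lemma isLRep_etaCrossStar (P : CrossedProductHost hL α C) (ρ : Rep C H) :
    hL.IsLRep (P.etaCrossStar ρ).2 :=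
  ⟨ρ.pullback P.ηL P.nondeg, P.etaStar_pullback ρ⟩

/-- Let `(π, σ̃ ∘ η)` be covariant. A representation of `C` with `η_A(a) η_L(l) ↦ π(a) σ(l)` is
non-degenerate, and its covariant representation is `(π, σ̃ ∘ η)`. -/
lemma mem_carriedReps_of_rep (P : CrossedProductHost hL α C) {π : A →⋆ₙₐ[ℂ] (H →L[ℂ] H)}
    {σ : Rep L H} (hπ : IsCovariantRep α π (etaStar hL.η σ)) {ρ : C →⋆ₙₐ[ℂ] (H →L[ℂ] H)}
    (hρ : ∀ a l c, DoubleCentralizer.coeHom (𝕜 := ℂ) c = P.ηA a * P.ηL l → ρ c = π a * σ.1 l) :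
    (π, etaStar hL.η σ) ∈ P.carriedReps H := by
  have hnd : NondegRep ρ := by
    intro y
    set K := Submodule.span ℂ {y : H | ∃ c x, ρ c x = y}
    have h1 (a : A) (x : H) : π a x ∈ K.topologicalClosure := by
      refine closure_minimal (t := π a ⁻¹' K.topologicalClosure) ?_
        (K.isClosed_topologicalClosure.preimage (π a).continuous) (σ.2 x)
      change Submodule.span ℂ _ ≤ K.topologicalClosure.comap (π a : H →ₗ[ℂ] H)
      rw [Submodule.span_le]
      rintro _ ⟨l, z, rfl⟩
      obtain ⟨c, hc⟩ := P.mul_mem a l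
      refine Submodule.le_topologicalClosure _ (Submodule.subset_span ⟨c, z, ?_⟩)
      rw [hρ a l c hc]
      rfl
    refine closure_minimal (t := (K.topologicalClosure : Set H)) ?_
      K.isClosed_topologicalClosure (hπ.nondeg y)
    change Submodule.span ℂ _ ≤ K.topologicalClosure
    rw [Submodule.span_le]
    rintro _ ⟨a, x, rfl⟩
    exact h1 a x
  have hext {S T : H →L[ℂ] H} (h : ∀ a l, S * (π a * σ.1 l) = T * (π a * σ.1 l)) : S = T := by
    refine NondegAction.ext hπ.nondeg fun a x => ?_
    have : S * π a = T * π a := NondegAction.ext σ.2 fun l z =>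
      congrArg (fun R : H →L[ℂ] H => R z) (h a l)
    exact congrArg (fun R : H →L[ℂ] H => R x) this
  refine ⟨⟨ρ, hnd⟩, Prod.ext ?_ ?_⟩
  · ext a : 1
    refine hext fun b l => ?_
    obtain ⟨c, hc⟩ := P.mul_mem b l
    rw [etaCrossStar_fst_apply, ← hρ b l c hc, repExt_mul_apply (⟨ρ, hnd⟩ : Rep C H),
      hρ (a * b) l, map_mul, mul_assoc, hρ b l c hc]
    rw [← mul_coeHom, hc, map_mul, mul_assoc]
  · ext g : 2
    refine hext fun b l => ?_
    obtain ⟨c, hc⟩ := P.mul_mem b l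
    have hPcov : homExt P.ηL P.nondeg (hL.η g : 𝓜(ℂ, L)) * P.ηA b
        = P.ηA (α g b) * homExt P.ηL P.nondeg (hL.η g : 𝓜(ℂ, L)) := by
      have hu : star (homExt P.ηL P.nondeg (hL.η g : 𝓜(ℂ, L)))
          * homExt P.ηL P.nondeg (hL.η g : 𝓜(ℂ, L)) = 1 :=
        Unitary.star_mul_self_of_mem (P.ηG g).2
      rw [← P.covariant, mul_assoc, hu, mul_one]
    have hcov : (etaStar hL.η σ g : H →L[ℂ] H) * π b
        = π (α g b) * (etaStar hL.η σ g : H →L[ℂ] H) := by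
      rw [← hπ.covariant, mul_assoc _ (star _), Unitary.star_mul_self_of_mem (etaStar hL.η σ g).2,
        mul_one]
    change repExt ρ hnd (P.ηG g : 𝓜(ℂ, C)) * (π b * σ.1 l)
      = (etaStar hL.η σ g : H →L[ℂ] H) * (π b * σ.1 l)
    rw [← mul_assoc (etaStar hL.η σ g : H →L[ℂ] H), hcov, mul_assoc, coe_etaStar,
      repExt_mul_apply, ← hρ b l c hc, repExt_mul_apply (⟨ρ, hnd⟩ : Rep C H), hρ (α g b) ((hL.η g : 𝓜(ℂ, L)).fst l)]
    rw [← mul_coeHom, hc, coe_ηG, ← mul_assoc, hPcov, mul_assoc, ← homExt_coe P.ηL P.nondeg l,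
      ← map_mul, mul_coeHom, homExt_coe]

lemma IsFull.carriedReps_eq {P : CrossedProductHost hL α C} (hP : P.IsFull) :
    P.carriedReps H = {x | IsCovariantRep α x.1 x.2 ∧ hL.IsLRep x.2} := by
  ext ⟨π, U⟩
  refine ⟨?_, ?_⟩
  · rintro ⟨ρ, hρ⟩
    rw [← hρ]
    exact ⟨P.isCovariantRep_etaCrossStar ρ, P.isLRep_etaCrossStar ρ⟩
  · rintro ⟨hcov, hU⟩
    have hσ : etaStar hL.η (hL.lRep hU) = U := hU.choose_spec
    obtain ⟨ρ, hρ, -⟩ := hP H π U hcov hU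
    change IsCovariantRep α π U at hcov
    have := P.mem_carriedReps_of_rep (σ := hL.lRep hU) (hσ.symm ▸ hcov) hρ
    rwa [hσ] at this

end CrossedProductHost

end CPHost

theorem mainTheorem1 {G : Type v} [Group G] [TopologicalSpace G] [IsTopologicalGroup G]
    {L : Type u} [NonUnitalCStarAlgebra L] (hL : CPHost.HostAlgebra G L)
    {A : Type w} [NonUnitalCStarAlgebra A] (α : G →* (A ≃⋆ₐ[ℂ] A)) :
    (∀ (C D : Type u) [NonUnitalCStarAlgebra C] [NonUnitalCStarAlgebra D]
      (P : CPHost.CrossedProductHost hL α C) (Q : CPHost.CrossedProductHost hL α D),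
      (∀ (H : Type u) [NormedAddCommGroup H] [InnerProductSpace ℂ H] [CompleteSpace H],
        P.carriedReps H = Q.carriedReps H) →
      ∃! Φ : C ≃⋆ₐ[ℂ] D, P.Intertwines Q Φ) ∧
    (∀ (C D : Type u) [NonUnitalCStarAlgebra C] [NonUnitalCStarAlgebra D]
      (P : CPHost.CrossedProductHost hL α C) (Q : CPHost.CrossedProductHost hL α D),
      P.IsFull → Q.IsFull → P.Isomorphic Q) :=
  ⟨fun _ _ _ _ _ _ h => CPHost.CrossedProductHost.existsUnique_intertwines h,
    fun _ _ _ _ _ _ hP hQ =>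
      (CPHost.CrossedProductHost.existsUnique_intertwines fun H _ _ _ => by
        rw [hP.carriedReps_eq, hQ.carriedReps_eq]).exists⟩
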